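/- Let $\Sigma=(A,B,C,D;\mathcal X,\mathcal U,\mathcal Y)$ be a linear discrete time-invariant system $x_{n+1}=Ax_n+Bu_n$, $y_n=Cx_n+Du_n$, where $A:\mathcal X\to\mathcal X$, $B:\mathcal U\to\mathcal X$, $C:\mathcal X\to\mathcal Y$, $D:\mathcal U\to\mathcal Y$ are bounded linear operators between separable complex Hilbert spaces. For a bounded selfadjoint operator $T$ on a Hilbert space, $T^{[-1]}$ denotes its Moore–Penrose pseudo-inverse, i.e. the (possibly unbounded) operator with domain $\operatorname{Im}T\oplus\operatorname{Ker}T$ that is zero on $\operatorname{Ker}T$ and inverts the restriction of $T$ to $\overline{\operatorname{Im}T}$. For a (possibly unbounded) selfadjoint operator $H$ in $\mathcal X$ with $\langle Hx,x\rangle>0$ for all $0\ne x\in\mathcal D(H)$, $H^{1/2}$ denotes its positive selfadjoint square root. Consider the following conditions on a (possibly unbounded) selfadjoint operator $H$ in $\mathcal X$: (C1) $\langle Hx,x\rangle>0$ for every $0\neq x\in\mathcal D(H)$; (C2) $A\mathcal D(H^{1/2})\subset\mathcal D(H^{1/2})$ and $B\,\mathcal U\subset\mathcal D(H^{1/2})$;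 (C3) the operator $\delta_\Sigma(H)=I_{\mathcal U}-D^*D-(H^{1/2}B)^*H^{1/2}B$ is bounded and nonnegative, and $\big(D^*C+(H^{1/2}B)^*H^{1/2}A\big)\mathcal D(H^{1/2})\subset\delta_\Sigma(H)^{1/2}\,\mathcal U$; (CI4) for each $x\in\mathcal D(H^{1/2})$, $$\|H^{1/2}x\|^2-\|H^{1/2}Ax\|^2-\|Cx\|^2\ \ge\ \Big\|\big(\delta_\Sigma(H)^{1/2}\big)^{[-1]}\big(D^*C+(H^{1/2}B)^*H^{1/2}A\big)x\Big\|^2;$$ (K) for all $x\in\mathcal D(H^{1/2})$ and $u\in\mathcal U$, $$\|H^{1/2}x\|^2+\|u\|^2-\|H^{1/2}(Ax+Bu)\|^2-\|Cx+Du\|^2\ \ge\ 0.$$ Let $\mathrm{RI}_\Sigma$ (the generalized solutions of the Riccati inequality) be the set of all selfadjoint $H$ in $\mathcal X$ satisfying (C1), (C2), (C3) and (CI4), and let $\mathrm{KYP}_\Sigma$ (the generalized solutions of the Kalman–Yakubovich–Popov inequality) be the set of all selfadjoint $H$ in $\mathcal X$ satisfying (C1), (C2) and (K). Put $\operatorname{Im}(A|B)=\operatorname{span}\{\operatorname{Im}A^nB\mid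 n\ge0\}$ and $\operatorname{Im}(A^*|C^*)=\operatorname{span}\{\operatorname{Im}(A^*)^nC^*\mid n\ge0\}$. Let $\mathrm{RI}^\circ_\Sigma$ and $\mathrm{KYP}^\circ_\Sigma$ be the subsets of $\mathrm{RI}_\Sigma$ and $\mathrm{KYP}_\Sigma$, respectively, of those $H$ for which (a) both $H^{1/2}\operatorname{Im}(A|B)$ and $H^{-1/2}\operatorname{Im}(A^*|C^*)$ are dense in $\mathcal X$, and (b) $\operatorname{Im}(A|B)$ is a core for $H^{1/2}$. Then a selfadjoint operator $H$ in $\mathcal X$ belongs to $\mathrm{RI}_\Sigma$ if and only if it belongs to $\mathrm{KYP}_\Sigma$; that is, $\mathrm{RI}_\Sigma=\mathrm{KYP}_\Sigma$. Consequently, $\mathrm{RI}^\circ_\Sigma=\mathrm{KYP}^\circ_\Sigma$. -/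

import Mathlib

/-! ### Linear discrete time-invariant systems -/

/-- The system `x (n+1) = A x n + B u n`, `y n = C x n + D u n` with bounded operators,
state space `X`, input space `U` and output space `Y`. -/
structure LinSystem (X U Y : Type*)
    [NormedAddCommGroup X] [InnerProductSpace ℂ X]
    [NormedAddCommGroup U] [InnerProductSpace ℂ U]
    [NormedAddCommGroup Y] [InnerProductSpace ℂ Y] where
  A : X →L[ℂ] X
  B : U →L[ℂ] X
  C : X →L[ℂ] Y
  D : U →L[ℂ] Y

/-- The linear manifold `im (A|B)`, the linear span of the ranges of `A ^ n B`, `n ≥ 0`. -/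
def reachManifold {X U : Type*}
    [NormedAddCommGroup X] [InnerProductSpace ℂ X]
    [NormedAddCommGroup U] [InnerProductSpace ℂ U]
    (A : X →L[ℂ] X) (B : U →L[ℂ] X) : Submodule ℂ X :=
  Submodule.span ℂ {x | ∃ (n : ℕ) (u : U), x = (A ^ n) (B u)}

/-! ### Positive selfadjoint operators and their square roots -/

section Operators

variable {X : Type*} [NormedAddCommGroup X] [InnerProductSpace ℂ X]

/-- `⟪H x, x⟫ > 0` for all nonzero `x` in the domain of `H`; the real part is taken because the
inner product takes values in `ℂ` (for selfadjoint `H` the value is real). -/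
def IsStrictlyPositiveOp (H : X →ₗ.[ℂ] X) : Prop :=
  ∀ x : H.domain, x ≠ 0 → 0 < (inner ℂ (H x) (x : X)).re

/-- `S` is the positive selfadjoint square root `H^{1/2}` of the positive selfadjoint operator `H`:
`S` is positive selfadjoint, `dom H = {x ∈ dom S | S x ∈ dom S}`, and `H x = S (S x)` on `dom H`.
For a positive selfadjoint `H` there is exactly one such `S`. -/
structure IsPosSqrt [CompleteSpace X] (H S : X →ₗ.[ℂ] X) : Prop where
  selfAdjoint : IsSelfAdjoint S
  positive : IsStrictlyPositiveOp S
  mem_domain_iff : ∀ x : X, x ∈ H.domain ↔ ∃ hx : x ∈ S.domain, S ⟨x, hx⟩ ∈ S.domain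
  apply_eq : ∀ (x : X) (h : x ∈ H.domain) (hx : x ∈ S.domain) (hSx : S ⟨x, hx⟩ ∈ S.domain),
    H ⟨x, h⟩ = S ⟨S ⟨x, hx⟩, hSx⟩

end Operators

/-! ### The Moore–Penrose pseudo-inverse of a bounded selfadjoint operator -/

section MoorePenrose

variable {U : Type*} [NormedAddCommGroup U] [InnerProductSpace ℂ U]

/-- The set of pairs `(T v + w, v)` with `v` in the closure of the range of `T` and `w` in the
kernel of `T`. -/
def mpGraph (T : U →L[ℂ] U) : Submodule ℂ (U × U) where
  carrier := {p | p.2 ∈ T.range.topologicalClosure ∧ p.1 - T p.2 ∈ T.ker}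
  add_mem' := by
    rintro p q ⟨hp, hp'⟩ ⟨hq, hq'⟩
    refine ⟨add_mem hp hq, ?_⟩
    have h := add_mem hp' hq'
    have e : (p + q).1 - T (p + q).2 = p.1 - T p.2 + (q.1 - T q.2) := by
      simp only [Prod.fst_add, Prod.snd_add, map_add]; abel
    rwa [e]
  zero_mem' := by simp
  smul_mem' := by
    rintro c p ⟨hp, hp'⟩
    refine ⟨Submodule.smul_mem _ c hp, ?_⟩
    have h := Submodule.smul_mem _ c hp'
    have e : (c • p).1 - T (c • p).2 = c • (p.1 - T p.2) := by
      simp only [Prod.smul_fst, Prod.smul_snd, map_smul, smul_sub]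
    rwa [e]

/-- The Moore–Penrose pseudo-inverse `T^{[-1]}` of a bounded selfadjoint operator `T`: the (possibly
unbounded) operator with domain `range T ⊕ ker T` that vanishes on `ker T` and inverts the
restriction of `T` to the closure of its range. -/
noncomputable def mpInverse (T : U →L[ℂ] U) : U →ₗ.[ℂ] U := (mpGraph T).toLinearPMap

/-- For selfadjoint `T`, the graph of `mpInverse T` is the one described above. -/
theorem mpInverse_graph [CompleteSpace U] {T : U →L[ℂ] U} (hT : IsSelfAdjoint T) :
    (mpInverse T).graph = mpGraph T := by
  refine Submodule.toLinearPMap_graph_eq _ ?_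
  rintro ⟨y, v⟩ ⟨h1, h2⟩ (rfl : y = 0)
  have hsym : ∀ a b : U, inner ℂ (T a) b = inner ℂ a (T b) := fun a b => by
    rw [← ContinuousLinearMap.adjoint_inner_right, hT.adjoint_eq]
  have h3 : T (T v) = 0 := by simpa using h2
  have h4 : T v = 0 := by
    have : inner ℂ (T v) (T v) = 0 := by rw [hsym, h3, inner_zero_right]
    exact inner_self_eq_zero.mp this
  have h5 : v ∈ T.rangeᗮ := by
    rw [Submodule.mem_orthogonal]
    rintro _ ⟨a, rfl⟩
    change inner ℂ (T a) v = 0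
    rw [hsym, h4, inner_zero_right]
  have h6 : v ∈ (T.range.topologicalClosure)ᗮ := by
    rwa [Submodule.orthogonal_closure]
  exact inner_self_eq_zero.mp (Submodule.inner_right_of_mem_orthogonal h1 h6)

end MoorePenrose

/-! ### Generalized solutions of the Riccati and the Kalman–Yakubovich–Popov inequality -/

namespace LinSystem

variable {X U Y : Type*}
  [NormedAddCommGroup X] [InnerProductSpace ℂ X] [CompleteSpace X]
  [NormedAddCommGroup U] [InnerProductSpace ℂ U] [CompleteSpace U]
  [NormedAddCommGroup Y] [InnerProductSpace ℂ Y]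

/-- The invariance conditions for `S = H^{1/2}`: `A (dom S) ⊆ dom S` and `B U ⊆ dom S`. -/
structure Invariant (σ : LinSystem X U Y) (S : X →ₗ.[ℂ] X) : Prop where
  A_mem : ∀ x ∈ S.domain, σ.A x ∈ S.domain
  B_mem : ∀ u : U, σ.B u ∈ S.domain

/-- The operator `S B` with `S = H^{1/2}`; it is bounded by the closed graph theorem. -/
noncomputable def rootB (σ : LinSystem X U Y) {S : X →ₗ.[ℂ] X} (hS : IsSelfAdjoint S)
    (hσ : σ.Invariant S) : U →L[ℂ] X :=
  ContinuousLinearMap.ofIsClosedGraph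
    (g := S.toFun.comp (LinearMap.codRestrict S.domain (σ.B : U →ₗ[ℂ] X) hσ.B_mem)) (by
      have hc : _root_.IsClosed (S.graph : Set (X × X)) := hS.isClosed
      have hcont : Continuous (fun p : U × X => (σ.B p.1, p.2)) := by fun_prop
      convert hc.preimage hcont using 1
      ext p
      simp only [SetLike.mem_coe, LinearMap.mem_graph_iff, Set.mem_preimage,
        LinearPMap.mem_graph_iff]
      constructor
      · intro h
        exact ⟨⟨σ.B p.1, hσ.B_mem p.1⟩, rfl, h.symm⟩
      · rintro ⟨z, hz, hz'⟩
        have : z = ⟨σ.B p.1, hσ.B_mem p.1⟩ := Subtype.ext hz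
        rw [← hz', this]
        rfl)

@[simp]
theorem rootB_apply (σ : LinSystem X U Y) {S : X →ₗ.[ℂ] X} (hS : IsSelfAdjoint S)
    (hσ : σ.Invariant S) (u : U) : σ.rootB hS hσ u = S ⟨σ.B u, hσ.B_mem u⟩ := rfl

variable [CompleteSpace Y]

/-- The bounded operator `δ = I - D* D - (S B)* (S B)` on `U`, with `S = H^{1/2}`. -/
noncomputable def defect (σ : LinSystem X U Y) {S : X →ₗ.[ℂ] X} (hS : IsSelfAdjoint S)
    (hσ : σ.Invariant S) : U →L[ℂ] U :=
  ContinuousLinearMap.id ℂ U - ContinuousLinearMap.adjoint σ.D ∘L σ.D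
    - ContinuousLinearMap.adjoint (σ.rootB hS hσ) ∘L σ.rootB hS hσ

/-- The vector `(D* C + (S B)* S A) x` for `x ∈ dom S`, with `S = H^{1/2}`. -/
noncomputable def cross (σ : LinSystem X U Y) {S : X →ₗ.[ℂ] X} (hS : IsSelfAdjoint S)
    (hσ : σ.Invariant S) (x : S.domain) : U :=
  ContinuousLinearMap.adjoint σ.D (σ.C x)
    + ContinuousLinearMap.adjoint (σ.rootB hS hσ) (S ⟨σ.A x, hσ.A_mem x x.2⟩)

/-- The operator `δ` is nonnegative and `(D* C + (S B)* S A) (dom S) ⊆ δ^{1/2} U`. -/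
structure DefectCondition (σ : LinSystem X U Y) {S : X →ₗ.[ℂ] X} (hS : IsSelfAdjoint S)
    (hσ : σ.Invariant S) : Prop where
  nonneg : (σ.defect hS hσ).IsPositive
  cross_mem : ∀ x : S.domain, σ.cross hS hσ x ∈ (CFC.sqrt (σ.defect hS hσ)).range

/-- The Riccati inequality: for each `x ∈ dom S`, where `S = H^{1/2}`,
`‖S x‖² - ‖S A x‖² - ‖C x‖² ≥ ‖(δ^{1/2})^{[-1]} (D* C + (S B)* S A) x‖²`
(with the vector on the right in the domain of the pseudo-inverse). -/
def RiccatiInequality (σ : LinSystem X U Y) {S : X →ₗ.[ℂ] X} (hS : IsSelfAdjoint S)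
    (hσ : σ.Invariant S) : Prop :=
  ∀ x : S.domain,
    ∃ hx : σ.cross hS hσ x ∈ (mpInverse (CFC.sqrt (σ.defect hS hσ))).domain,
      ‖S x‖ ^ 2 - ‖S ⟨σ.A x, hσ.A_mem x x.2⟩‖ ^ 2 - ‖σ.C x‖ ^ 2 ≥
        ‖mpInverse (CFC.sqrt (σ.defect hS hσ)) ⟨σ.cross hS hσ x, hx⟩‖ ^ 2

/-- `RI_σ`: the generalized solutions of the Riccati inequality associated to `σ`. -/
def RI (σ : LinSystem X U Y) : Set (X →ₗ.[ℂ] X) :=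
  {H | IsSelfAdjoint H ∧ IsStrictlyPositiveOp H ∧
    ∃ (S : X →ₗ.[ℂ] X) (hS : IsPosSqrt H S) (hσ : σ.Invariant S),
      σ.DefectCondition hS.selfAdjoint hσ ∧ σ.RiccatiInequality hS.selfAdjoint hσ}

/-- `K_σ(H)` evaluated at `(x, u)`, where `S = H^{1/2}`: the squared norm of `(S x, u)` in `X ⊕ U`
minus the squared norm of `(S (A x + B u), C x + D u)` in `X ⊕ Y`. -/
noncomputable def kypForm (σ : LinSystem X U Y) {S : X →ₗ.[ℂ] X} (hσ : σ.Invariant S)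
    (x : S.domain) (u : U) : ℝ :=
  (‖S x‖ ^ 2 + ‖u‖ ^ 2)
    - (‖S ⟨σ.A x + σ.B u, add_mem (hσ.A_mem x x.2) (hσ.B_mem u)⟩‖ ^ 2 + ‖σ.C x + σ.D u‖ ^ 2)

/-- `KYP_σ`: the generalized solutions of the Kalman–Yakubovich–Popov inequality associated
to `σ`. -/
def KYP (σ : LinSystem X U Y) : Set (X →ₗ.[ℂ] X) :=
  {H | IsSelfAdjoint H ∧ IsStrictlyPositiveOp H ∧
    ∃ (S : X →ₗ.[ℂ] X) (_ : IsPosSqrt H S) (hσ : σ.Invariant S),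
      ∀ (x : S.domain) (u : U), 0 ≤ σ.kypForm hσ x u}

/-- The two additional conditions for `S = H^{1/2}`: `H^{1/2} im (A|B)` and
`H^{-1/2} im (A*|C*)` are dense in `X`, and `im (A|B)` is a core for `H^{1/2}`. -/
structure CoreMinimal (σ : LinSystem X U Y) (S : X →ₗ.[ℂ] X) : Prop where
  dense_image : Dense {z : X | ∃ x : S.domain, (x : X) ∈ reachManifold σ.A σ.B ∧ z = S x}
  dense_preimage :
    Dense {z : X | ∃ hz : z ∈ S.domain,
      S ⟨z, hz⟩ ∈
        reachManifold (ContinuousLinearMap.adjoint σ.A) (ContinuousLinearMap.adjoint σ.C)}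
  core : S.HasCore (reachManifold σ.A σ.B)

/-- `RI_σ°`: the elements of `RI_σ` that satisfy the two additional conditions. -/
def RIcirc (σ : LinSystem X U Y) : Set (X →ₗ.[ℂ] X) :=
  {H | H ∈ σ.RI ∧ ∃ S : X →ₗ.[ℂ] X, IsPosSqrt H S ∧ σ.CoreMinimal S}

/-- `KYP_σ°`: the elements of `KYP_σ` that satisfy the two additional conditions. -/
def KYPcirc (σ : LinSystem X U Y) : Set (X →ₗ.[ℂ] X) :=
  {H | H ∈ σ.KYP ∧ ∃ S : X →ₗ.[ℂ] X, IsPosSqrt H S ∧ σ.CoreMinimal S}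

end LinSystem

/-! ### Factorization through a selfadjoint operator -/

/-! Fix `x` in the domain of `S = H^{1/2}`, and put T = δ^{1/2}, c = `cross x`, p = ‖Sx‖² - ‖SAx‖² -
‖Cx‖². Expanding the squares turns the KYP form into p + ‖Tu‖² - 2 Re⟪c, u⟫. If c = Tv, this equals
(p - ‖v‖²) + ‖v - Tu‖², so the Riccati inequality ‖v‖² ≤ p gives nonnegativity for all u.
Conversely, x = 0 gives δ ≥ 0. For general x, nonnegativity in all u forces |⟪c, u⟫| ≤ √p ‖Tu‖, and
a Douglas-type factorization (`exists_mem_closure_range_of_norm_inner_le`) yields c = Tv with v in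
the closure of the range of T and ‖v‖² ≤ p. This v is the value of the pseudo-inverse at c. -/

section Factorization

variable {U : Type*} [NormedAddCommGroup U] [InnerProductSpace ℂ U]

/-- If `2 Re ⟪c, u⟫ ≤ p + ‖T u‖²` for all `u`, then `‖⟪c, u⟫‖² ≤ p ‖T u‖²`. -/
theorem norm_inner_sq_le_of_forall_two_mul_re_inner_le {T : U →L[ℂ] U} {c : U} {p : ℝ}
    (h : ∀ u, 2 * (inner ℂ c u).re ≤ p + ‖T u‖ ^ 2) (u : U) :
    ‖inner ℂ c u‖ ^ 2 ≤ p * ‖T u‖ ^ 2 := by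
  have hp : 0 ≤ p := by simpa using h 0
  set w : ℂ := inner ℂ c u with hw
  rcases eq_or_ne w 0 with h0 | h0
  · rw [h0]
    simp only [norm_zero, ne_eq, OfNat.ofNat_ne_zero, not_false_eq_true, zero_pow]
    positivity
  -- Replacing u by t · conj(w) · u makes the inner product the real number t‖w‖², so the hypothesis
  -- becomes a nonnegative quadratic in t. Its discriminant gives the bound after cancelling ‖w‖².
  have key : ∀ t : ℝ, 0 ≤ ‖w‖ ^ 2 * ‖T u‖ ^ 2 * (t * t) + -(2 * ‖w‖ ^ 2) * t + p := by
    intro t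
    have h1 := h (((t : ℂ) * (starRingEnd ℂ) w) • u)
    have h2 : inner ℂ c (((t : ℂ) * (starRingEnd ℂ) w) • u) = ((t * ‖w‖ ^ 2 : ℝ) : ℂ) := by
      rw [inner_smul_right, ← hw, mul_assoc, Complex.conj_mul']
      push_cast
      ring
    rw [h2, Complex.ofReal_re, map_smul, norm_smul, norm_mul, RCLike.norm_conj,
      Complex.norm_real, mul_pow, mul_pow, Real.norm_eq_abs, sq_abs] at h1
    linarith
  have hd := discrim_le_zero key
  have hw2 : 0 < ‖w‖ ^ 2 := by positivity
  rw [discrim] at hd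
  refine le_of_mul_le_mul_left ?_ hw2
  linarith

variable [CompleteSpace U]

/-- If `‖⟪c, u⟫‖ ≤ r ‖T u‖` for all `u`, then `c = T v` for some `v` in the closure of the range
of the selfadjoint operator `T` with `‖v‖ ≤ r`. -/
theorem exists_mem_closure_range_of_norm_inner_le {T : U →L[ℂ] U} (hT : IsSelfAdjoint T)
    {c : U} {r : ℝ} (hr : 0 ≤ r) (h : ∀ u, ‖inner ℂ c u‖ ≤ r * ‖T u‖) :
    ∃ v ∈ T.range.topologicalClosure, T v = c ∧ ‖v‖ ≤ r := by
  obtain ⟨s, hs⟩ := (T : U →ₗ[ℂ] U).rangeRestrict.exists_rightInverse_of_surjective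
    (LinearMap.range_rangeRestrict _)
  have hs' : ∀ y : T.range, T (s y) = y := fun y =>
    congrArg Subtype.val (LinearMap.congr_fun hs y)
  -- The section `s` need not be bounded, but the functional Tu ↦ ⟪c, u⟫ is, by `h`.
  let f : StrongDual ℂ T.range :=
    (((innerSL ℂ c : U →L[ℂ] ℂ) : U →ₗ[ℂ] ℂ) ∘ₗ s).mkContinuous r (fun y => by
      have := h (s y)
      rw [hs'] at this
      simpa using this)
  have hf : ‖f‖ ≤ r := LinearMap.mkContinuous_norm_le _ hr _
  -- The choice of preimage is irrelevant: two preimages differ by an element of ker T, where `h`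
  -- makes ⟪c, ·⟫ vanish.
  have hfT : ∀ u, f ⟨T u, u, rfl⟩ = inner ℂ c u := by
    intro u
    have h1 := h (s ⟨T u, u, rfl⟩ - u)
    rw [map_sub, hs', sub_self, norm_zero, mul_zero, norm_le_zero_iff, inner_sub_right,
      sub_eq_zero] at h1
    exact h1
  -- Hahn–Banach followed by Riesz represents the functional by a vector `v'` of norm at most r.
  obtain ⟨g, hg, hgf⟩ := exists_extension_norm_eq T.range f
  let v' : U := (InnerProductSpace.toDual ℂ U).symm g
  have hv' : ∀ u, inner ℂ v' (T u) = inner ℂ c u := fun u => by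
    rw [InnerProductSpace.toDual_symm_apply, ← hfT u]
    exact hg ⟨T u, u, rfl⟩
  have hn : ‖v'‖ ≤ r := by
    rw [LinearIsometryEquiv.norm_map, hgf]
    exact hf
  let K := T.range.topologicalClosure
  have : CompleteSpace K := (Submodule.isClosed_topologicalClosure _).completeSpace_coe
  -- Projecting onto the closed range leaves all products with Tu unchanged and does not increase
  -- the norm.
  refine ⟨K.starProjection v', Submodule.coe_mem _, ?_,
    (Submodule.norm_starProjection_apply_le K v').trans hn⟩
  refine ext_inner_right ℂ fun u => ?_
  have hTu : T u ∈ K := Submodule.le_topologicalClosure _ ⟨u, rfl⟩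
  rw [← ContinuousLinearMap.adjoint_inner_right, hT.adjoint_eq,
    Submodule.inner_starProjection_left_eq_right,
    Submodule.starProjection_eq_self_iff.mpr hTu, hv']

theorem exists_mem_closure_range_of_forall_two_mul_re_inner_le {T : U →L[ℂ] U}
    (hT : IsSelfAdjoint T) {c : U} {p : ℝ}
    (h : ∀ u, 2 * (inner ℂ c u).re ≤ p + ‖T u‖ ^ 2) :
    ∃ v ∈ T.range.topologicalClosure, T v = c ∧ ‖v‖ ^ 2 ≤ p := by
  have hp : 0 ≤ p := by simpa using h 0
  obtain ⟨v, hv, hTv, hn⟩ := exists_mem_closure_range_of_norm_inner_le hT (Real.sqrt_nonneg p)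
    (c := c) (fun u => by
      refine abs_le_of_sq_le_sq' ?_ (by positivity) |>.2
      rw [mul_pow, Real.sq_sqrt hp]
      exact norm_inner_sq_le_of_forall_two_mul_re_inner_le h u)
  refine ⟨v, hv, hTv, ?_⟩
  calc ‖v‖ ^ 2 ≤ √p ^ 2 := by gcongr
    _ = p := Real.sq_sqrt hp

theorem mpInverse_domain_apply {T : U →L[ℂ] U} (hT : IsSelfAdjoint T) {v : U}
    (hv : v ∈ T.range.topologicalClosure) :
    ∃ h : T v ∈ (mpInverse T).domain, mpInverse T ⟨T v, h⟩ = v := by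
  have hg : (T v, v) ∈ (mpInverse T).graph := by
    rw [mpInverse_graph hT]
    exact ⟨hv, by simp⟩
  obtain ⟨⟨y, hy⟩, rfl, h2⟩ := LinearPMap.mem_graph_iff _ |>.mp hg
  exact ⟨hy, h2⟩

/-- The residual c - T v, with v the pseudo-inverse at c, lies in both the kernel and the range of
T. These are orthogonal for selfadjoint T, so it vanishes. -/
theorem map_mpInverse_of_mem_range {T : U →L[ℂ] U} (hT : IsSelfAdjoint T) {c : U}
    (hc : c ∈ (mpInverse T).domain) (hr : c ∈ T.range) : T (mpInverse T ⟨c, hc⟩) = c := by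
  have hg : (c, mpInverse T ⟨c, hc⟩) ∈ mpGraph T := by
    rw [← mpInverse_graph hT]
    exact (mpInverse T).mem_graph ⟨c, hc⟩
  have hk : T (c - T (mpInverse T ⟨c, hc⟩)) = 0 := hg.2
  obtain ⟨a, rfl⟩ := hr
  set d := T a - T (mpInverse T ⟨T a, hc⟩) with hd
  have hd' : d = T (a - mpInverse T ⟨T a, hc⟩) := by rw [map_sub]
  have h0 : inner ℂ d d = 0 := by
    nth_rewrite 1 [hd']
    rw [← ContinuousLinearMap.adjoint_inner_right, hT.adjoint_eq]
    exact (congrArg _ hk).trans (inner_zero_right _)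
  exact (sub_eq_zero.mp (inner_self_eq_zero.mp h0)).symm

theorem isSelfAdjoint_cfcSqrt (δ : U →L[ℂ] U) : IsSelfAdjoint (CFC.sqrt δ) :=
  IsSelfAdjoint.of_nonneg (CFC.sqrt_nonneg δ)

theorem norm_cfcSqrt_apply_sq {δ : U →L[ℂ] U} (hδ : δ.IsPositive) (u : U) :
    ‖CFC.sqrt δ u‖ ^ 2 = (inner ℂ (δ u) u).re := by
  have h : CFC.sqrt δ (CFC.sqrt δ u) = δ u :=
    congrArg (fun f : U →L[ℂ] U => f u)
      (CFC.sqrt_mul_sqrt_self δ ((ContinuousLinearMap.nonneg_iff_isPositive δ).mpr hδ))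
  rw [← h, ← ContinuousLinearMap.adjoint_inner_right, (isSelfAdjoint_cfcSqrt δ).adjoint_eq,
    ← inner_self_eq_norm_sq (𝕜 := ℂ)]
  rfl

end Factorization

/-! ### Completing the square in the Kalman–Yakubovich–Popov form -/

namespace LinSystem

variable {X U Y : Type*}
  [NormedAddCommGroup X] [InnerProductSpace ℂ X] [CompleteSpace X]
  [NormedAddCommGroup U] [InnerProductSpace ℂ U] [CompleteSpace U]
  [NormedAddCommGroup Y] [InnerProductSpace ℂ Y] [CompleteSpace Y]

theorem re_inner_defect (σ : LinSystem X U Y) {S : X →ₗ.[ℂ] X} (hS : IsSelfAdjoint S)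
    (hσ : σ.Invariant S) (u : U) :
    (inner ℂ (σ.defect hS hσ u) u).re =
      ‖u‖ ^ 2 - ‖σ.D u‖ ^ 2 - ‖S ⟨σ.B u, hσ.B_mem u⟩‖ ^ 2 := by
  simp only [defect, sub_apply, ContinuousLinearMap.id_apply,
    ContinuousLinearMap.comp_apply, inner_sub_left, ContinuousLinearMap.adjoint_inner_left,
    map_sub, rootB_apply, ← RCLike.re_eq_complex_re, inner_self_eq_norm_sq]

theorem inner_cross (σ : LinSystem X U Y) {S : X →ₗ.[ℂ] X} (hS : IsSelfAdjoint S)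
    (hσ : σ.Invariant S) (x : S.domain) (u : U) :
    inner ℂ (σ.cross hS hσ x) u = inner ℂ (σ.C x) (σ.D u) +
      inner ℂ (S ⟨σ.A x, hσ.A_mem x x.2⟩) (S ⟨σ.B u, hσ.B_mem u⟩) := by
  simp only [cross, inner_add_left, ContinuousLinearMap.adjoint_inner_left, rootB_apply]

theorem kypForm_eq (σ : LinSystem X U Y) {S : X →ₗ.[ℂ] X} (hS : IsSelfAdjoint S)
    (hσ : σ.Invariant S) (x : S.domain) (u : U) :
    σ.kypForm hσ x u =
      (‖S x‖ ^ 2 - ‖S ⟨σ.A x, hσ.A_mem x x.2⟩‖ ^ 2 - ‖σ.C x‖ ^ 2)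
        + (inner ℂ (σ.defect hS hσ u) u).re - 2 * (inner ℂ (σ.cross hS hσ x) u).re := by
  have hadd : S ⟨σ.A x + σ.B u, add_mem (hσ.A_mem x x.2) (hσ.B_mem u)⟩ =
      S ⟨σ.A x, hσ.A_mem x x.2⟩ + S ⟨σ.B u, hσ.B_mem u⟩ :=
    S.map_add ⟨σ.A x, hσ.A_mem x x.2⟩ ⟨σ.B u, hσ.B_mem u⟩
  rw [kypForm, hadd, re_inner_defect, inner_cross, @norm_add_sq ℂ, @norm_add_sq ℂ, Complex.add_re]
  simp only [RCLike.re_eq_complex_re]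
  ring

theorem kypForm_nonneg_of_riccati (σ : LinSystem X U Y) {S : X →ₗ.[ℂ] X}
    (hS : IsSelfAdjoint S) (hσ : σ.Invariant S) (hδ : σ.DefectCondition hS hσ)
    (hR : σ.RiccatiInequality hS hσ) (x : S.domain) (u : U) : 0 ≤ σ.kypForm hσ x u := by
  obtain ⟨hx, hle⟩ := hR x
  have hT := isSelfAdjoint_cfcSqrt (σ.defect hS hσ)
  have hv := map_mpInverse_of_mem_range hT hx (hδ.cross_mem x)
  set v := mpInverse (CFC.sqrt (σ.defect hS hσ)) ⟨σ.cross hS hσ x, hx⟩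
  have hi : inner ℂ (σ.cross hS hσ x) u = inner ℂ v (CFC.sqrt (σ.defect hS hσ) u) := by
    rw [← hv, ← ContinuousLinearMap.adjoint_inner_right, hT.adjoint_eq]
  -- The square to complete is ‖v - δ^{1/2}u‖².
  have hsq := @norm_sub_sq ℂ _ _ _ _ v (CFC.sqrt (σ.defect hS hσ) u)
  rw [RCLike.re_eq_complex_re] at hsq
  rw [kypForm_eq σ hS, ← norm_cfcSqrt_apply_sq hδ.nonneg, hi]
  linarith [sq_nonneg ‖v - CFC.sqrt (σ.defect hS hσ) u‖]

theorem defect_isPositive_of_kypForm_nonneg (σ : LinSystem X U Y) {S : X →ₗ.[ℂ] X}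
    (hS : IsSelfAdjoint S) (hσ : σ.Invariant S)
    (h : ∀ (x : S.domain) (u : U), 0 ≤ σ.kypForm hσ x u) : (σ.defect hS hσ).IsPositive := by
  refine ⟨fun u w => ?_, fun u => ?_⟩
  · simp only [defect, ContinuousLinearMap.coe_coe, sub_apply, ContinuousLinearMap.id_apply,
      ContinuousLinearMap.comp_apply, inner_sub_left, inner_sub_right,
      ContinuousLinearMap.adjoint_inner_left, ContinuousLinearMap.adjoint_inner_right]
  -- At x = 0 only the term ⟪δu, u⟫ of the form survives.
  · have h0 := h 0 u
    have hA : (⟨σ.A (0 : S.domain), hσ.A_mem _ (0 : S.domain).2⟩ : S.domain) = 0 :=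
      Subtype.ext (by simp)
    rw [kypForm_eq σ hS, inner_cross, hA] at h0
    simpa [ContinuousLinearMap.reApplyInnerSelf] using h0

theorem riccati_of_kypForm_nonneg (σ : LinSystem X U Y) {S : X →ₗ.[ℂ] X}
    (hS : IsSelfAdjoint S) (hσ : σ.Invariant S)
    (h : ∀ (x : S.domain) (u : U), 0 ≤ σ.kypForm hσ x u) :
    σ.DefectCondition hS hσ ∧ σ.RiccatiInequality hS hσ := by
  have hδ := σ.defect_isPositive_of_kypForm_nonneg hS hσ h
  have hT := isSelfAdjoint_cfcSqrt (σ.defect hS hσ)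
  -- For fixed x, nonnegativity in u is the hypothesis of the factorization lemma with T = δ^{1/2}.
  -- One `v` serves both the range inclusion and the norm bound.
  have key : ∀ x : S.domain, ∃ v ∈ (CFC.sqrt (σ.defect hS hσ)).range.topologicalClosure,
      CFC.sqrt (σ.defect hS hσ) v = σ.cross hS hσ x ∧
        ‖v‖ ^ 2 ≤ ‖S x‖ ^ 2 - ‖S ⟨σ.A x, hσ.A_mem x x.2⟩‖ ^ 2 - ‖σ.C x‖ ^ 2 := fun x =>
    exists_mem_closure_range_of_forall_two_mul_re_inner_le hT fun u => by
      have := h x u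
      rw [kypForm_eq σ hS, ← norm_cfcSqrt_apply_sq hδ] at this
      linarith
  refine ⟨⟨hδ, fun x => ?_⟩, fun x => ?_⟩
  · obtain ⟨v, -, hv, -⟩ := key x
    exact ⟨v, hv⟩
  · obtain ⟨v, hmem, hv, hle⟩ := key x
    obtain ⟨hd, hval⟩ := mpInverse_domain_apply hT hmem
    simp only [hv] at hd hval
    exact ⟨hd, by rw [hval]; exact hle⟩

theorem RI_eq_KYP (σ : LinSystem X U Y) : σ.RI = σ.KYP := by
  ext H
  constructor
  · rintro ⟨hH, hpos, S, hS, hσ, hδ, hR⟩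
    exact ⟨hH, hpos, S, hS, hσ, σ.kypForm_nonneg_of_riccati hS.selfAdjoint hσ hδ hR⟩
  · rintro ⟨hH, hpos, S, hS, hσ, h⟩
    exact ⟨hH, hpos, S, hS, hσ, σ.riccati_of_kypForm_nonneg hS.selfAdjoint hσ h⟩

end LinSystem

theorem mainTheorem6 {X U Y : Type*}
    [NormedAddCommGroup X] [InnerProductSpace ℂ X] [CompleteSpace X]
    [TopologicalSpace.SeparableSpace X]
    [NormedAddCommGroup U] [InnerProductSpace ℂ U] [CompleteSpace U]
    [TopologicalSpace.SeparableSpace U]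
    [NormedAddCommGroup Y] [InnerProductSpace ℂ Y] [CompleteSpace Y]
    [TopologicalSpace.SeparableSpace Y]
    (σ : LinSystem X U Y) :
    σ.RI = σ.KYP ∧ σ.RIcirc = σ.KYPcirc :=
  ⟨σ.RI_eq_KYP, by simp only [LinSystem.RIcirc, LinSystem.KYPcirc, σ.RI_eq_KYP]⟩
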